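/- Let $d\in\mathbb N$ and let $\mathfrak B$ be a finite-dimensional Pontryagin space of rational $d\times 1$ vector functions, i.e. a finite-dimensional complex vector space of such functions with a nondegenerate, possibly indefinite, Hermitian inner product $[\,\cdot\,,\cdot\,]_{\mathfrak B}$ (linear in the first variable). Let $\Omega\subset\mathbb C$ be the finite set of all poles in $\mathbb C$ of the functions in $\mathfrak B$. Let $S_{\mathfrak B}$ be the operator of multiplication by the independent variable in $\mathfrak B$, $(S_{\mathfrak B}f)(z)=zf(z)$, with domain $\{f\in\mathfrak B: zf(z)\in\mathfrak B\}$, and for $\alpha\in\mathbb C\setminus\Omega$ let $E_\alpha f=f(\alpha)$. Let $K(z,w)$, $z,w\in\mathbb C\setminus\Omega$, be the reproducing kernel of $\mathfrak B$: the $d\times d$ matrix function with $K(\,\cdot\,,w)x\in\mathfrak B$ and $[f,K(\,\cdot\,,w)x]_{\mathfrak B}=x^*f(w)$ for all $f\in\mathfrak B$, $x\in\mathbb C^d$, $w\in\mathbb C\setminus\Omega$. Call $K$ a rational Nevanlinna kernel if there are rational $d\times d$ matrix functions $M$ and $N$, holomorphic on $\mathrm{hol}(M)$ and $\mathrm{hol}(N)$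 (the complements in $\mathbb C$ of their pole sets), such that $$M(z)N(z^*)^*-N(z)M(z^*)^*=0\quad\text{whenever } z,z^*\in\mathrm{hol}(M)\cap\mathrm{hol}(N),$$ $$\operatorname{rank}\,[\,M(z)\ \ N(z)\,]=d\quad\text{for at least one } z\in\mathrm{hol}(M)\cap\mathrm{hol}(N),$$ $$K(z,w)=\frac{M(z)N(w)^*-N(z)M(w)^*}{z-w^*}\quad\text{for all } z,w\in(\mathrm{hol}(M)\cap\mathrm{hol}(N))\setminus\Omega,\ z\neq w^*.$$ Then $K$ is a rational Nevanlinna kernel if and only if the following two conditions hold: (a) $S_{\mathfrak B}$ is symmetric in $\mathfrak B$, i.e. $[S_{\mathfrak B}f,g]_{\mathfrak B}=[f,S_{\mathfrak B}g]_{\mathfrak B}$ for all $f,g$ in the domain of $S_{\mathfrak B}$; (b) for some $\alpha\in\mathbb C\setminus\Omega$ we have $\operatorname{ran}(S_{\mathfrak B}-\alpha)=\mathfrak B\cap\ker E_\alpha$. -/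

import Mathlib

open scoped Matrix ComplexConjugate

noncomputable section

namespace RationalPontryagin

/-- A finite dimensional Pontryagin space of rational `d × 1` vector functions: a finite dimensional
complex vector space of such functions with an inner product (linear in the first variable,
conjugate linear in the second, Hermitian, possibly indefinite) that is nondegenerate. In finite
dimension nondegeneracy is all that is needed for an inner product space to be a Pontryagin space. -/
structure PontryaginSpace (d : ℕ) where
  carrier : Submodule ℂ (Fin d → RatFunc ℂ)
  finiteDimensional : FiniteDimensional ℂ carrier
  inner : carrier →ₗ[ℂ] carrier →ₗ⋆[ℂ] ℂ
  conj_symm : ∀ f g, conj (inner f g) = inner g f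
  nondegenerate : ∀ f, (∀ g, inner f g = 0) → f = 0

/-- `z` is a pole of the rational function `r`: a zero of its reduced denominator. -/
def IsPole (r : RatFunc ℂ) (z : ℂ) : Prop := r.denom.eval z = 0

/-- The value `r(z)` (meaningful if `z` is not a pole of `r`). -/
def value (r : RatFunc ℂ) (z : ℂ) : ℂ := r.eval (RingHom.id ℂ) z

namespace PontryaginSpace

variable {d : ℕ} (𝔅 : PontryaginSpace d)

/-- The set `Ω` of all poles in `ℂ` of the functions in `𝔅`. -/
def poles : Set ℂ := {z | ∃ f ∈ 𝔅.carrier, ∃ i, IsPole (f i) z}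

/-- The operator `E_α : 𝔅 → ℂ^d` of evaluation at a point `α ∉ Ω`. -/
def evalAt (α : ℂ) (hα : α ∉ 𝔅.poles) : 𝔅.carrier →ₗ[ℂ] (Fin d → ℂ) where
  toFun f := fun i => value (f.1 i) α
  map_add' f g := by
    have h : ∀ (f : 𝔅.carrier) (i : Fin d), (f.1 i).denom.eval₂ (RingHom.id ℂ) α ≠ 0 :=
      fun f i h0 => hα ⟨f.1, f.2, i, h0⟩
    funext i
    exact RatFunc.eval_add (f := RingHom.id ℂ) (a := α) (h f i) (h g i)
  map_smul' c f := by
    have h : ∀ (f : 𝔅.carrier) (i : Fin d), (f.1 i).denom.eval₂ (RingHom.id ℂ) α ≠ 0 :=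
      fun f i h0 => hα ⟨f.1, f.2, i, h0⟩
    funext i
    have h1 : (RatFunc.C c : RatFunc ℂ).denom.eval₂ (RingHom.id ℂ) α ≠ 0 := by simp
    have h2 := RatFunc.eval_mul (f := RingHom.id ℂ) (a := α) h1 (h f i)
    simpa [value, RatFunc.smul_eq_C_mul] using h2

/-- The operator `S_𝔅` of multiplication by the independent variable in `𝔅`, with domain
`{f ∈ 𝔅 : z f(z) ∈ 𝔅}`. -/
def mulOp : 𝔅.carrier →ₗ.[ℂ] 𝔅.carrier where
  domain :=
    { carrier := {f | (RatFunc.X : RatFunc ℂ) • f.1 ∈ 𝔅.carrier}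
      add_mem' := by
        intro f g hf hg
        simpa [smul_add] using 𝔅.carrier.add_mem hf hg
      zero_mem' := by simp
      smul_mem' := by
        intro c f hf
        have := 𝔅.carrier.smul_mem c hf
        rw [smul_comm] at this
        simpa using this }
  toFun :=
    { toFun := fun f => ⟨(RatFunc.X : RatFunc ℂ) • f.1.1, f.2⟩
      map_add' := by
        intro f g
        ext1
        simp [smul_add]
      map_smul' := by
        intro c f
        ext1
        exact smul_comm _ _ _ }

/-- `S_𝔅` is symmetric: `[S f, g] = [f, S g]` for all `f, g` in its (not necessarily dense)
domain. -/
def MulOpSymmetric : Prop :=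
  ∀ f g : 𝔅.mulOp.domain, 𝔅.inner (𝔅.mulOp f) g.1 = 𝔅.inner f.1 (𝔅.mulOp g)

/-- The range of `S_𝔅 - α`. -/
def ranMulOpSub (α : ℂ) : Submodule ℂ 𝔅.carrier :=
  LinearMap.range (𝔅.mulOp.toFun - α • 𝔅.mulOp.domain.subtype)

/-- `K`, considered on `(ℂ ∖ Ω) × (ℂ ∖ Ω)`, is the reproducing kernel of `𝔅`: for `w ∉ Ω` and
`x ∈ ℂ^d` the function `K(·, w) x` belongs to `𝔅` and `[f, K(·, w) x] = x^* f(w)` for `f ∈ 𝔅`. -/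
def IsReproducingKernel (K : ℂ → ℂ → Matrix (Fin d) (Fin d) ℂ) : Prop :=
  ∀ (w : ℂ) (hw : w ∉ 𝔅.poles) (x : Fin d → ℂ), ∃ k : 𝔅.carrier,
    (∀ (z : ℂ) (hz : z ∉ 𝔅.poles), 𝔅.evalAt z hz k = K z w *ᵥ x) ∧
    ∀ f : 𝔅.carrier, 𝔅.inner f k = star x ⬝ᵥ 𝔅.evalAt w hw f

/-- Every linear functional on `𝔅` is represented by the inner product. -/
theorem exists_representer (φ : Module.Dual ℂ 𝔅.carrier) :
    ∃ k : 𝔅.carrier, ∀ f, 𝔅.inner f k = φ f := by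
  have := 𝔅.finiteDimensional
  let T : 𝔅.carrier →ₗ⋆[ℂ] Module.Dual ℂ 𝔅.carrier := 𝔅.inner.flip
  have hT : LinearMap.range T = ⊤ := by
    have h0 : (LinearMap.range T).dualCoannihilator = ⊥ := by
      rw [eq_bot_iff]
      intro f hf
      rw [Submodule.mem_dualCoannihilator] at hf
      exact 𝔅.nondegenerate f fun g => hf (T g) ⟨g, rfl⟩
    rw [← Subspace.dualCoannihilator_dualAnnihilator_eq (W := LinearMap.range T), h0]
    exact Submodule.dualAnnihilator_bot
  obtain ⟨k, hk⟩ := (LinearMap.range_eq_top.mp hT) φ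
  exact ⟨k, fun f => by rw [← hk]; rfl⟩

/-- The reproducing kernel exists. -/
theorem exists_isReproducingKernel : ∃ K, 𝔅.IsReproducingKernel K := by
  classical
  have h : ∀ w : ℂ, ∀ j : Fin d, ∃ k : 𝔅.carrier, ∀ hw : w ∉ 𝔅.poles, ∀ f : 𝔅.carrier,
      𝔅.inner f k = 𝔅.evalAt w hw f j := by
    intro w j
    by_cases hw : w ∈ 𝔅.poles
    · exact ⟨0, fun h => absurd hw h⟩
    · obtain ⟨k, hk⟩ := 𝔅.exists_representer (LinearMap.proj j ∘ₗ 𝔅.evalAt w hw)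
      exact ⟨k, fun _ f => hk f⟩
  choose k hk using h
  refine ⟨fun z w => Matrix.of fun i j => value ((k w j).1 i) z, fun w hw x =>
    ⟨∑ j, x j • k w j, fun z hz => ?_, fun f => ?_⟩⟩
  · rw [map_sum]
    funext i
    simp [Matrix.mulVec, dotProduct, evalAt, mul_comm]
  · simp [map_sum, hk w _ hw, dotProduct, evalAt]

/-- The reproducing kernel is unique on `(ℂ ∖ Ω) × (ℂ ∖ Ω)`. -/
theorem isReproducingKernel_unique {K L : ℂ → ℂ → Matrix (Fin d) (Fin d) ℂ}
    (hK : 𝔅.IsReproducingKernel K) (hL : 𝔅.IsReproducingKernel L) {z w : ℂ}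
    (hz : z ∉ 𝔅.poles) (hw : w ∉ 𝔅.poles) : K z w = L z w := by
  apply Matrix.ext_of_mulVec_single
  intro j
  obtain ⟨k, hk, hk'⟩ := hK w hw (Pi.single j 1)
  obtain ⟨l, hl, hl'⟩ := hL w hw (Pi.single j 1)
  have hkl : k - l = 0 := by
    refine 𝔅.nondegenerate _ fun g => ?_
    rw [← 𝔅.conj_symm, map_sub, hk', hl', sub_self, map_zero]
  rw [← hk z hz, ← hl z hz, sub_eq_zero.mp hkl]

end PontryaginSpace

variable {d : ℕ}

/-- The domain of holomorphy in `ℂ` of a rational matrix function. -/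
def hol (M : Matrix (Fin d) (Fin d) (RatFunc ℂ)) : Set ℂ := {z | ∀ i j, ¬ IsPole (M i j) z}

/-- The value `M(z)` of a rational matrix function (meaningful for `z ∈ hol M`). -/
def matValue (M : Matrix (Fin d) (Fin d) (RatFunc ℂ)) (z : ℂ) : Matrix (Fin d) (Fin d) ℂ :=
  M.map fun r => value r z

/-- The kernel `(M(z) N(w)^* - N(z) M(w)^*) / (z - w^*)`, used for `z, w ∈ hol M ∩ hol N` with
`z ≠ w^*`. -/
def nevanlinnaKernel (M N : Matrix (Fin d) (Fin d) (RatFunc ℂ)) (z w : ℂ) :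
    Matrix (Fin d) (Fin d) ℂ :=
  (z - conj w)⁻¹ • (matValue M z * (matValue N w)ᴴ - matValue N z * (matValue M w)ᴴ)

/-- `K`, defined on `U × U` with `U` the complement of a finite set, is a rational Nevanlinna kernel:
it coincides, as a rational function of `z` and `w^*`, with the kernel of a pair of rational matrix
functions `M`, `N` such that `M(z) N(z^*)^* = N(z) M(z^*)^*` (wherever both sides are defined) and
`[M(z) N(z)]` has rank `d` for at least one `z`. -/
def IsRationalNevanlinnaKernel (U : Set ℂ) (K : ℂ → ℂ → Matrix (Fin d) (Fin d) ℂ) : Prop :=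
  ∃ M N : Matrix (Fin d) (Fin d) (RatFunc ℂ),
    (∀ z ∈ hol M ∩ hol N, conj z ∈ hol M ∩ hol N →
      matValue M z * (matValue N (conj z))ᴴ - matValue N z * (matValue M (conj z))ᴴ = 0) ∧
    (∃ z ∈ hol M ∩ hol N, (Matrix.fromCols (matValue M z) (matValue N z)).rank = d) ∧
    ∀ z ∈ U ∩ (hol M ∩ hol N), ∀ w ∈ U ∩ (hol M ∩ hol N), z ≠ conj w →
      K z w = nevanlinnaKernel M N z w

end RationalPontryagin

end

/-! ### Values of rational functions -/

noncomputable section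

namespace RationalPontryagin

open Filter

/-! Both directions work at a real point `α` outside a finite exceptional set, where `S - α` is
symmetric exactly when `S` is.

From the kernel to (a), (b): multiplying `K(·,w)x` by `z - w^*` gives `M a - N b` with `a = N(w)^*
x`, `b = M(w)^* x`. Kernel functions span `𝔅`, so every `u` has some `f` with `(z - α) f - u = M a -
N b` and `[u, g] = [f, (S - α) g]` on the domain of `S`. If `u(α) = 0`, evaluation at `α` gives
`M(α) a = N(α) b`; full rank and a dimension count (`exists_eq_conjTranspose_mulVec`) yield `a =
N(α)^* x`, `b = M(α)^* x`. Subtracting `K(·,α)x` from `f` leaves an exact quotient `u / (z - α)` in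
`𝔅` and keeps the pairing identity. This gives the range condition and symmetry at once.

Conversely, (b) at one point spreads to almost all points by comparing dimensions, hence to a real
`α`. There `(S - α)⁻¹` is a symmetric operator on `ker E_α`, and it extends to a selfadjoint `T` on
`𝔅`. Since `f(z) - (z - α)(T f)(z)` depends only on `f(α)`, it equals `N(z) f(α)` for a rational
`N`. With `M(z) = (z - α) K(z, α)`, selfadjointness of `T` gives `K(·,α) N(w)^* x = (1 - (w^* - α)
T) K(·,w) x`, and in `M(z) N(w)^* - N(z) M(w)^*` the terms containing `T` cancel, leaving `(z - w^*)
K(z, w)`. -/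

/-- The algebra of rational functions without a pole at `z`. -/
def regularAt (z : ℂ) : Subalgebra ℂ (RatFunc ℂ) where
  carrier := {r | ¬ IsPole r z}
  mul_mem' {a b} ha hb h := by
    have := Polynomial.eval_eq_zero_of_dvd_of_eval_eq_zero (RatFunc.denom_mul_dvd a b) h
    rw [Polynomial.eval_mul, mul_eq_zero] at this
    exact this.elim ha hb
  add_mem' {a b} ha hb h := by
    have := Polynomial.eval_eq_zero_of_dvd_of_eval_eq_zero (RatFunc.denom_add_dvd a b) h
    rw [Polynomial.eval_mul, mul_eq_zero] at this
    exact this.elim ha hb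
  algebraMap_mem' c := by simp [IsPole, RatFunc.algebraMap_eq_C]

theorem mem_regularAt {z : ℂ} {r : RatFunc ℂ} : r ∈ regularAt z ↔ ¬ IsPole r z := Iff.rfl

/-- Evaluation at `z` of the rational functions without a pole at `z`. -/
def evalHom (z : ℂ) : regularAt z →ₐ[ℂ] ℂ where
  toFun r := value r.1 z
  map_one' := by simp [value]
  map_zero' := by simp [value]
  map_mul' a b := RatFunc.eval_mul (f := RingHom.id ℂ) (a := z) a.2 b.2
  map_add' a b := RatFunc.eval_add (f := RingHom.id ℂ) (a := z) a.2 b.2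
  commutes' c := by simp [value, RatFunc.algebraMap_eq_C]

theorem X_mem_regularAt (z : ℂ) : (RatFunc.X : RatFunc ℂ) ∈ regularAt z := by
  simp [mem_regularAt, IsPole]

theorem C_mem_regularAt (c z : ℂ) : (RatFunc.C c : RatFunc ℂ) ∈ regularAt z := by
  simp [mem_regularAt, IsPole]

@[simp] theorem value_X (z : ℂ) : value RatFunc.X z = z := by simp [value]

@[simp] theorem value_C (c z : ℂ) : value (RatFunc.C c) z = c := by simp [value]

@[simp] theorem value_zero (z : ℂ) : value 0 z = 0 := by simp [value]

section value

variable {z : ℂ} {r s : RatFunc ℂ}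

theorem value_add (hr : r ∈ regularAt z) (hs : s ∈ regularAt z) :
    value (r + s) z = value r z + value s z := map_add (evalHom z) ⟨r, hr⟩ ⟨s, hs⟩

theorem value_sub (hr : r ∈ regularAt z) (hs : s ∈ regularAt z) :
    value (r - s) z = value r z - value s z := map_sub (evalHom z) ⟨r, hr⟩ ⟨s, hs⟩

theorem value_mul (hr : r ∈ regularAt z) (hs : s ∈ regularAt z) :
    value (r * s) z = value r z * value s z := map_mul (evalHom z) ⟨r, hr⟩ ⟨s, hs⟩

theorem value_sum {ι : Type*} (t : Finset ι) (f : ι → RatFunc ℂ) (hf : ∀ i, f i ∈ regularAt z) :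
    value (∑ i ∈ t, f i) z = ∑ i ∈ t, value (f i) z := by
  classical
  induction t using Finset.induction_on with
  | empty => simp
  | insert i t hi ih => rw [Finset.sum_insert hi, Finset.sum_insert hi,
      value_add (hf i) (sum_mem fun j _ => hf j), ih]

theorem X_sub_C_mem_regularAt (α z : ℂ) : (RatFunc.X - RatFunc.C α : RatFunc ℂ) ∈ regularAt z :=
  sub_mem (X_mem_regularAt z) (C_mem_regularAt α z)

theorem value_X_sub_C_mul (α : ℂ) (hr : r ∈ regularAt z) :
    value ((RatFunc.X - RatFunc.C α) * r) z = (z - α) * value r z := by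
  rw [value_mul (X_sub_C_mem_regularAt α z) hr,
    value_sub (X_mem_regularAt z) (C_mem_regularAt α z), value_X, value_C]

theorem continuousAt_value (hr : r ∈ regularAt z) : ContinuousAt (value r) z := by
  have h : value r = fun z => r.num.eval z / r.denom.eval z := by
    funext z
    simp [value, RatFunc.eval, Polynomial.eval₂_id]
  rw [h]
  exact r.num.continuous.continuousAt.div r.denom.continuous.continuousAt hr

theorem value_det {n : Type*} [Fintype n] [DecidableEq n] (A : Matrix n n (RatFunc ℂ))
    (hA : ∀ i j, A i j ∈ regularAt z) :
    value A.det z = (A.map fun r => value r z).det := by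
  have h1 := RingHom.map_det (evalHom z).toRingHom (Matrix.of fun i j => ⟨A i j, hA i j⟩)
  have h2 := RingHom.map_det (regularAt z).val.toRingHom (Matrix.of fun i j => ⟨A i j, hA i j⟩)
  have h3 : (regularAt z).val.toRingHom.mapMatrix (Matrix.of fun i j => ⟨A i j, hA i j⟩) = A := rfl
  rw [h3] at h2
  rw [← h2]
  exact h1

end value

theorem eventually_mem_regularAt (r : RatFunc ℂ) : ∀ᶠ z in cofinite, r ∈ regularAt z := by
  have := Polynomial.finite_setOfPred_isRoot (RatFunc.denom_ne_zero r)
  rw [Filter.eventually_cofinite]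
  simpa [mem_regularAt, IsPole, Polynomial.IsRoot] using this

theorem eventually_value_ne_zero {r : RatFunc ℂ} (hr : r ≠ 0) :
    ∀ᶠ z in cofinite, value r z ≠ 0 := by
  have h := Polynomial.finite_setOfPred_isRoot (RatFunc.num_ne_zero hr)
  filter_upwards [eventually_mem_regularAt r, h.compl_mem_cofinite] with z hz hz'
  exact div_ne_zero (by simpa [Polynomial.IsRoot, Polynomial.eval₂_id] using hz') hz

theorem eq_of_eventually_value_eq {r s : RatFunc ℂ}
    (h : ∀ᶠ z in cofinite, value r z = value s z) : r = s := by
  by_contra hne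
  obtain ⟨z, h1, h2, h3, h4⟩ := (h.and ((eventually_value_ne_zero (sub_ne_zero.mpr hne)).and
    ((eventually_mem_regularAt r).and (eventually_mem_regularAt s)))).exists
  exact h2 (by rw [value_sub h3 h4, h1, sub_self])

/-- A rational matrix function that is invertible at one point is invertible at almost all. -/
theorem eventually_det_ne_zero {n : Type*} [Fintype n] [DecidableEq n]
    (A : Matrix n n (RatFunc ℂ)) {α : ℂ} (hA : ∀ i j, A i j ∈ regularAt α)
    (hdet : (A.map fun r => value r α).det ≠ 0) :
    ∀ᶠ β in cofinite, (A.map fun r => value r β).det ≠ 0 := by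
  have h0 : A.det ≠ 0 := by
    intro h
    rw [← value_det A hA, h, value_zero] at hdet
    exact hdet rfl
  have hreg : ∀ᶠ β in cofinite, ∀ i j, A i j ∈ regularAt β :=
    Filter.eventually_all.mpr fun i => Filter.eventually_all.mpr fun j =>
      eventually_mem_regularAt _
  filter_upwards [hreg, eventually_value_ne_zero h0] with β hβ h
  rwa [← value_det A hβ]

/-- A property of almost all complex numbers holds for a real number. -/
theorem exists_real_of_eventually_cofinite {p : ℂ → Prop} (h : ∀ᶠ z in cofinite, p z) :
    ∃ α : ℂ, conj α = α ∧ p α := by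
  obtain ⟨x, hx⟩ := (Complex.ofReal_injective.tendsto_cofinite.eventually h).exists
  exact ⟨x, Complex.conj_ofReal x, hx⟩

/-! ### Poles, duality and the range of `S - α` -/

namespace PontryaginSpace

variable {d : ℕ} (𝔅 : PontryaginSpace d)

theorem finite_poles : 𝔅.poles.Finite := by
  have := 𝔅.finiteDimensional
  obtain ⟨s, hs⟩ := Module.Finite.iff_fg.mp this
  have h : ∀ᶠ z in cofinite, ∀ f ∈ s, ∀ i, f i ∈ regularAt z :=
    (Filter.eventually_all_finset s).mpr fun f _ => Filter.eventually_all.mpr fun i =>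
      eventually_mem_regularAt _
  refine Set.Finite.subset (Filter.eventually_cofinite.mp h) ?_
  rintro z ⟨f, hf, i, hi⟩ hz
  rw [← hs] at hf
  have : ∀ i, f i ∈ regularAt z := by
    clear hi i
    induction hf using Submodule.span_induction with
    | mem f hf => exact hz f hf
    | zero => exact fun i => zero_mem _
    | add f g _ _ hf hg => exact fun i => add_mem (hf i) (hg i)
    | smul c f _ hf => exact fun i => Subalgebra.smul_mem _ (hf i) c
  exact this i hi

theorem eventually_not_mem_poles : ∀ᶠ z in cofinite, z ∉ 𝔅.poles :=
  𝔅.finite_poles.compl_mem_cofinite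

variable {𝔅}

theorem mem_regularAt_of_not_mem_poles {z : ℂ} (hz : z ∉ 𝔅.poles) (f : 𝔅.carrier) (i : Fin d) :
    f.1 i ∈ regularAt z := fun h => hz ⟨f.1, f.2, i, h⟩

theorem evalAt_apply {z : ℂ} (hz : z ∉ 𝔅.poles) (f : 𝔅.carrier) (i : Fin d) :
    𝔅.evalAt z hz f i = value (f.1 i) z := rfl

theorem eq_zero_of_inner_left_eq_zero {k : 𝔅.carrier} (h : ∀ f, 𝔅.inner f k = 0) : k = 0 :=
  𝔅.nondegenerate k fun g => by rw [← 𝔅.conj_symm, h, map_zero]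

theorem ext_inner_left {k l : 𝔅.carrier} (h : ∀ f, 𝔅.inner f k = 𝔅.inner f l) : k = l :=
  sub_eq_zero.mp <| eq_zero_of_inner_left_eq_zero fun f => by rw [map_sub, h, sub_self]

theorem eq_of_eventually_evalAt_eq {f g : 𝔅.carrier}
    (h : ∀ᶠ z in cofinite, ∀ hz : z ∉ 𝔅.poles, 𝔅.evalAt z hz f = 𝔅.evalAt z hz g) : f = g := by
  refine Subtype.ext (funext fun i => eq_of_eventually_value_eq ?_)
  filter_upwards [h, 𝔅.eventually_not_mem_poles] with z h hz
  exact congrFun (h hz) i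

/-- A subspace whose orthogonal companion is trivial is the whole space. -/
theorem eq_top_of_forall_inner_eq_zero {W : Submodule ℂ 𝔅.carrier}
    (h : ∀ f, (∀ k ∈ W, 𝔅.inner f k = 0) → f = 0) : W = ⊤ := by
  by_contra hW
  obtain ⟨φ, hφ, hW⟩ := Submodule.exists_le_ker_of_lt_top W (lt_top_iff_ne_top.mpr hW)
  obtain ⟨k, hk⟩ := 𝔅.exists_representer φ
  have : k = 0 := h k fun g hg => by rw [← 𝔅.conj_symm, hk, hW hg, map_zero]
  exact hφ (LinearMap.ext fun f => by simp [← hk, this])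

theorem X_smul_eq_of_mem_ranMulOpSub {α : ℂ} {u : 𝔅.carrier} :
    u ∈ 𝔅.ranMulOpSub α ↔ ∃ f : 𝔅.carrier, u.1 = (RatFunc.X - RatFunc.C α) • f.1 := by
  constructor
  · rintro ⟨f, rfl⟩
    refine ⟨f.1, ?_⟩
    change (RatFunc.X : RatFunc ℂ) • f.1.1 - α • f.1.1 = _
    ext i
    simp [sub_mul, RatFunc.smul_eq_C_mul]
  · rintro ⟨f, hf⟩
    have h : (RatFunc.X : RatFunc ℂ) • f.1 = u.1 + α • f.1 := by
      rw [hf]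
      ext i
      simp [sub_mul, RatFunc.smul_eq_C_mul]
    refine ⟨⟨f, ?_⟩, ?_⟩
    · change (RatFunc.X : RatFunc ℂ) • f.1 ∈ 𝔅.carrier
      rw [h]
      exact add_mem u.2 (𝔅.carrier.smul_mem _ f.2)
    · refine Subtype.ext ?_
      change (RatFunc.X : RatFunc ℂ) • f.1 - α • f.1 = u.1
      rw [h, add_sub_cancel_right]

theorem ranMulOpSub_le_ker {α : ℂ} (hα : α ∉ 𝔅.poles) :
    𝔅.ranMulOpSub α ≤ LinearMap.ker (𝔅.evalAt α hα) := by
  intro u hu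
  obtain ⟨f, hf⟩ := X_smul_eq_of_mem_ranMulOpSub.mp hu
  rw [LinearMap.mem_ker]
  funext i
  rw [evalAt_apply, hf]
  simp [value_X_sub_C_mul α (mem_regularAt_of_not_mem_poles hα f i)]

end PontryaginSpace

/-! ### Matrix pairs of full rank and the functions `M a - N b` -/

section LinearAlgebra

variable {d : ℕ}

theorem exists_mul_add_mul_eq_one {A B : Matrix (Fin d) (Fin d) ℂ}
    (h : (Matrix.fromCols A B).rank = d) : ∃ C D, A * C + B * D = 1 := by
  have hs : Function.Surjective (Matrix.fromCols A B).mulVec := by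
    have : LinearMap.range (Matrix.fromCols A B).mulVecLin = ⊤ := by
      apply Submodule.eq_top_of_finrank_eq
      rw [← Matrix.rank, h, Module.finrank_fin_fun]
    exact LinearMap.range_eq_top.mp this
  obtain ⟨E, hE⟩ := Matrix.mulVec_surjective_iff_exists_right_inverse.mp hs
  refine ⟨E.toRows₁, E.toRows₂, ?_⟩
  rw [← hE, ← Matrix.fromCols_mul_fromRows, Matrix.fromRows_toRows]

/-- The range of `x ↦ (B^* x, A^* x)` is all of the kernel of `(a, b) ↦ A a - B b` if it is
contained in it and `[A B]` has full rank. -/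
theorem exists_eq_conjTranspose_mulVec {A B C D : Matrix (Fin d) (Fin d) ℂ}
    (hAB : A * Bᴴ - B * Aᴴ = 0) (hdet : (A * C + B * D).det ≠ 0) {a b : Fin d → ℂ}
    (hab : A *ᵥ a - B *ᵥ b = 0) : ∃ x, a = Bᴴ *ᵥ x ∧ b = Aᴴ *ᵥ x := by
  -- `ran Φ ⊆ ker Ψ`, `Φ` is injective and `Ψ` is onto, so both subspaces have dimension `d`.
  let Φ : (Fin d → ℂ) →ₗ[ℂ] (Fin d → ℂ) × (Fin d → ℂ) := Bᴴ.mulVecLin.prod Aᴴ.mulVecLin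
  let Ψ : (Fin d → ℂ) × (Fin d → ℂ) →ₗ[ℂ] (Fin d → ℂ) := A.mulVecLin.coprod (-B.mulVecLin)
  have hle : LinearMap.range Φ ≤ LinearMap.ker Ψ := by
    rintro _ ⟨x, rfl⟩
    have : (A * Bᴴ - B * Aᴴ) *ᵥ x = 0 := by rw [hAB, Matrix.zero_mulVec]
    rw [Matrix.sub_mulVec] at this
    simpa [Φ, Ψ, sub_eq_add_neg] using this
  have hΦ : LinearMap.ker Φ = ⊥ := by
    rw [eq_bot_iff]
    intro x hx
    obtain ⟨h1, h2⟩ : Bᴴ *ᵥ x = 0 ∧ Aᴴ *ᵥ x = 0 := by simpa [Φ] using hx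
    refine Matrix.eq_zero_of_mulVec_eq_zero (M := (A * C + B * D)ᴴ) ?_ ?_
    · rw [Matrix.det_conjTranspose]
      simpa using hdet
    · rw [Matrix.conjTranspose_add, Matrix.conjTranspose_mul, Matrix.conjTranspose_mul,
        Matrix.add_mulVec, ← Matrix.mulVec_mulVec, ← Matrix.mulVec_mulVec, h1, h2]
      simp
  have hΨ : LinearMap.range Ψ = ⊤ := by
    rw [LinearMap.range_eq_top]
    intro y
    have hu : IsUnit (A * C + B * D).det := isUnit_iff_ne_zero.mpr hdet
    refine ⟨(C *ᵥ ((A * C + B * D)⁻¹ *ᵥ y), -(D *ᵥ ((A * C + B * D)⁻¹ *ᵥ y))), ?_⟩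
    have : (A * C + B * D) *ᵥ ((A * C + B * D)⁻¹ *ᵥ y) = y := by
      rw [Matrix.mulVec_mulVec, Matrix.mul_nonsing_inv _ hu, Matrix.one_mulVec]
    rw [Matrix.add_mulVec, ← Matrix.mulVec_mulVec, ← Matrix.mulVec_mulVec] at this
    simpa only [Ψ, LinearMap.coprod_apply, LinearMap.neg_apply, Matrix.mulVecLin_apply,
      Matrix.mulVec_neg, neg_neg] using this
  have h1 := LinearMap.finrank_range_add_finrank_ker Φ
  have h2 := LinearMap.finrank_range_add_finrank_ker Ψ
  rw [hΦ, finrank_bot, Module.finrank_fin_fun] at h1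
  rw [hΨ, finrank_top, Module.finrank_prod, Module.finrank_fin_fun] at h2
  have heq := Submodule.eq_of_le_of_finrank_eq hle (by omega)
  have hmem : (a, b) ∈ LinearMap.ker Ψ := by simpa [Ψ, sub_eq_add_neg] using hab
  rw [← heq] at hmem
  obtain ⟨x, hx⟩ := hmem
  exact ⟨x, (congrArg Prod.fst hx).symm, (congrArg Prod.snd hx).symm⟩

end LinearAlgebra

section MatrixFunctions

variable {d : ℕ} (M N : Matrix (Fin d) (Fin d) (RatFunc ℂ))

theorem eventually_mem_hol : ∀ᶠ z in cofinite, z ∈ hol M :=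
  Filter.eventually_all.mpr fun i => Filter.eventually_all.mpr fun j =>
    eventually_mem_regularAt (M i j)

theorem mulVec_C_mem_regularAt {z : ℂ} (hz : z ∈ hol M) (a : Fin d → ℂ) (i : Fin d) :
    (M *ᵥ fun j => RatFunc.C (a j)) i ∈ regularAt z := by
  rw [Matrix.mulVec, dotProduct]
  exact sum_mem fun j _ => mul_mem (hz i j) (C_mem_regularAt (a j) z)

theorem value_mulVec_C {z : ℂ} (hz : z ∈ hol M) (a : Fin d → ℂ) (i : Fin d) :
    value ((M *ᵥ fun j => RatFunc.C (a j)) i) z = (matValue M z *ᵥ a) i := by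
  rw [Matrix.mulVec, dotProduct,
    value_sum _ _ fun j => mul_mem (hz i j) (C_mem_regularAt (a j) z)]
  refine Finset.sum_congr rfl fun j _ => ?_
  rw [value_mul (hz i j) (C_mem_regularAt (a j) z), value_C]
  rfl

/-- The rational vector function `M a - N b`. -/
def mulVecSub : (Fin d → ℂ) × (Fin d → ℂ) →ₗ[ℂ] (Fin d → RatFunc ℂ) where
  toFun p := (M *ᵥ fun j => RatFunc.C (p.1 j)) - N *ᵥ fun j => RatFunc.C (p.2 j)
  map_add' p q := by
    ext i
    simp [Matrix.mulVec, dotProduct, mul_add, Finset.sum_add_distrib]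
    ring
  map_smul' c p := by
    ext i
    simp [Matrix.mulVec, dotProduct, mul_sub, Finset.mul_sum, RatFunc.smul_eq_C_mul,
      mul_left_comm]

variable {M N}

theorem value_mulVecSub {z : ℂ} (hM : z ∈ hol M) (hN : z ∈ hol N)
    (p : (Fin d → ℂ) × (Fin d → ℂ)) (i : Fin d) :
    value (mulVecSub M N p i) z = (matValue M z *ᵥ p.1 - matValue N z *ᵥ p.2) i := by
  change value ((M *ᵥ fun j => RatFunc.C (p.1 j)) i - (N *ᵥ fun j => RatFunc.C (p.2 j)) i) z = _
  rw [value_sub (mulVec_C_mem_regularAt M hM p.1 i) (mulVec_C_mem_regularAt N hN p.2 i),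
    value_mulVec_C M hM, value_mulVec_C N hN]
  rfl

/-- Full rank at one point gives constant `C`, `D` with `M C + N D = 1` there. The determinant of `M
C + N D` is then a nonzero rational function, so full rank persists off a finite set, and in
particular at suitable real points. -/
theorem exists_eventually_det_ne_zero
    (h : ∃ z ∈ hol M ∩ hol N, (Matrix.fromCols (matValue M z) (matValue N z)).rank = d) :
    ∃ C D : Matrix (Fin d) (Fin d) ℂ,
      ∀ᶠ z in cofinite, (matValue M z * C + matValue N z * D).det ≠ 0 := by
  obtain ⟨z₀, ⟨hM, hN⟩, hr⟩ := h
  obtain ⟨C, D, h1⟩ := exists_mul_add_mul_eq_one hr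
  let A : Matrix (Fin d) (Fin d) (RatFunc ℂ) := Matrix.of fun i j =>
    (M *ᵥ fun k => RatFunc.C (C k j)) i + (N *ᵥ fun k => RatFunc.C (D k j)) i
  have hreg : ∀ z ∈ hol M, z ∈ hol N → ∀ i j, A i j ∈ regularAt z := fun z h1 h2 i j =>
    add_mem (mulVec_C_mem_regularAt M h1 _ i) (mulVec_C_mem_regularAt N h2 _ i)
  have hval : ∀ z ∈ hol M, z ∈ hol N →
      A.map (fun r => value r z) = matValue M z * C + matValue N z * D := by
    intro z h1 h2
    ext i j
    change value ((M *ᵥ fun k => RatFunc.C (C k j)) i + (N *ᵥ fun k => RatFunc.C (D k j)) i) z = _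
    rw [value_add (mulVec_C_mem_regularAt M h1 _ i) (mulVec_C_mem_regularAt N h2 _ i),
      value_mulVec_C M h1, value_mulVec_C N h2]
    rfl
  refine ⟨C, D, ?_⟩
  have := eventually_det_ne_zero A (hreg z₀ hM hN) (by rw [hval z₀ hM hN, h1]; simp)
  filter_upwards [this, eventually_mem_hol M, eventually_mem_hol N] with z h h1 h2
  rwa [← hval z h1 h2]

end MatrixFunctions

/-! ### From a Nevanlinna kernel to symmetry and the range condition -/

namespace PontryaginSpace

variable {d : ℕ} {𝔅 : PontryaginSpace d}

theorem evalAt_of_eq_X_sub_C_smul {α z : ℂ} (hz : z ∉ 𝔅.poles) {f g : 𝔅.carrier}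
    (h : f.1 = (RatFunc.X - RatFunc.C α) • g.1) :
    𝔅.evalAt z hz f = (z - α) • 𝔅.evalAt z hz g := by
  funext i
  rw [evalAt_apply, h]
  exact value_X_sub_C_mul α (mem_regularAt_of_not_mem_poles hz g i)

theorem X_sub_C_smul_injective (α : ℂ) {v w : Fin d → RatFunc ℂ}
    (h : (RatFunc.X - RatFunc.C α : RatFunc ℂ) • v = (RatFunc.X - RatFunc.C α : RatFunc ℂ) • w) :
    v = w := by
  refine smul_right_injective _ ?_ h
  intro h0
  -- At `α + 1` the function `X - α` has the value `1`, so it is not zero.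
  have h1 := value_sub (X_mem_regularAt (α + 1)) (C_mem_regularAt α (α + 1))
  rw [h0] at h1
  simp at h1

/-- Symmetry of `S_𝔅` tested on the shifted operator `S_𝔅 - α` with `α` real. -/
theorem mulOpSymmetric_iff {α : ℂ} (hα : conj α = α) :
    𝔅.MulOpSymmetric ↔ ∀ f g u v : 𝔅.carrier, u.1 = (RatFunc.X - RatFunc.C α) • f.1 →
      v.1 = (RatFunc.X - RatFunc.C α) • g.1 → 𝔅.inner u g = 𝔅.inner f v := by
  have hX : ∀ f u : 𝔅.carrier, u.1 = (RatFunc.X - RatFunc.C α) • f.1 ↔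
      (RatFunc.X : RatFunc ℂ) • f.1 = (u + α • f).1 := by
    intro f u
    rw [sub_smul, eq_sub_iff_add_eq, eq_comm]
    have : (RatFunc.C α : RatFunc ℂ) • f.1 = α • f.1 := by
      ext i
      simp [RatFunc.smul_eq_C_mul]
    rw [this]
    rfl
  constructor
  · intro h f g u v hu hv
    rw [hX] at hu hv
    have := h ⟨f, show (RatFunc.X : RatFunc ℂ) • f.1 ∈ 𝔅.carrier from hu ▸ (u + α • f).2⟩
      ⟨g, show (RatFunc.X : RatFunc ℂ) • g.1 ∈ 𝔅.carrier from hv ▸ (v + α • g).2⟩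
    have e1 : 𝔅.inner (u + α • f) g = 𝔅.inner f (v + α • g) := by
      convert this using 2
      · exact congrArg _ (Subtype.ext hu.symm)
      · exact Subtype.ext hv.symm
    simpa [hα] using e1
  · intro h f g
    have := h f.1 g.1 (𝔅.mulOp f - α • f.1) (𝔅.mulOp g - α • g.1)
      ((hX _ _).mpr (by rw [sub_add_cancel]; rfl)) ((hX _ _).mpr (by rw [sub_add_cancel]; rfl))
    simpa [hα] using this

variable {K : ℂ → ℂ → Matrix (Fin d) (Fin d) ℂ} {M N : Matrix (Fin d) (Fin d) (RatFunc ℂ)}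

theorem X_sub_C_smul_kernel_eq
    (hMN : ∀ z ∈ 𝔅.polesᶜ ∩ (hol M ∩ hol N), ∀ w ∈ 𝔅.polesᶜ ∩ (hol M ∩ hol N), z ≠ conj w →
      K z w = nevanlinnaKernel M N z w) {w : ℂ} (hw : w ∉ 𝔅.poles) (hM : w ∈ hol M)
    (hN : w ∈ hol N) {x : Fin d → ℂ} {k : 𝔅.carrier}
    (hk : ∀ (z : ℂ) (hz : z ∉ 𝔅.poles), 𝔅.evalAt z hz k = K z w *ᵥ x) :
    (RatFunc.X - RatFunc.C (conj w)) • k.1 =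
      mulVecSub M N ((matValue N w)ᴴ *ᵥ x, (matValue M w)ᴴ *ᵥ x) := by
  funext i
  apply eq_of_eventually_value_eq
  filter_upwards [𝔅.eventually_not_mem_poles, eventually_mem_hol M, eventually_mem_hol N,
    (Set.finite_singleton (conj w)).compl_mem_cofinite] with z hz hzM hzN hzw
  have hzw' : z ≠ conj w := hzw
  rw [value_mulVecSub hzM hzN]
  change value ((RatFunc.X - RatFunc.C (conj w)) * k.1 i) z = _
  rw [value_X_sub_C_mul _ (mem_regularAt_of_not_mem_poles hz k i), ← evalAt_apply hz, hk,
    hMN z ⟨hz, hzM, hzN⟩ w ⟨hw, hM, hN⟩ hzw', nevanlinnaKernel, Matrix.smul_mulVec,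
    Pi.smul_apply, smul_eq_mul, mul_inv_cancel_left₀ (sub_ne_zero.mpr hzw'), Matrix.sub_mulVec,
    Matrix.mulVec_mulVec, Matrix.mulVec_mulVec]

/-- Every element of `𝔅` is `(S^* - α) f` for the adjoint relation of `S_𝔅`, modulo a function
`M a - N b`. -/
theorem exists_X_sub_C_smul_sub_eq_mulVecSub (hK : 𝔅.IsReproducingKernel K)
    (hMN : ∀ z ∈ 𝔅.polesᶜ ∩ (hol M ∩ hol N), ∀ w ∈ 𝔅.polesᶜ ∩ (hol M ∩ hol N), z ≠ conj w →
      K z w = nevanlinnaKernel M N z w) {α : ℂ} (hα : conj α = α) (u : 𝔅.carrier) :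
    ∃ (f : 𝔅.carrier) (p : (Fin d → ℂ) × (Fin d → ℂ)),
      (RatFunc.X - RatFunc.C α) • f.1 - u.1 = mulVecSub M N p ∧
      ∀ g v : 𝔅.carrier, v.1 = (RatFunc.X - RatFunc.C α) • g.1 → 𝔅.inner u g = 𝔅.inner f v := by
  -- The required property is linear in `u`, so it suffices that it holds for kernel functions,
  -- whose common orthogonal companion is trivial.
  let W : Submodule ℂ 𝔅.carrier :=
    { carrier := {u | ∃ (f : 𝔅.carrier) (p : (Fin d → ℂ) × (Fin d → ℂ)),
        (RatFunc.X - RatFunc.C α) • f.1 - u.1 = mulVecSub M N p ∧ ∀ g v : 𝔅.carrier,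
          v.1 = (RatFunc.X - RatFunc.C α) • g.1 → 𝔅.inner u g = 𝔅.inner f v}
      zero_mem' := ⟨0, 0, by simp, by simp⟩
      add_mem' := by
        rintro u u' ⟨f, p, h1, h2⟩ ⟨f', p', h1', h2'⟩
        refine ⟨f + f', p + p', ?_, fun g v hv => ?_⟩
        · rw [map_add, ← h1, ← h1', Submodule.coe_add, Submodule.coe_add, smul_add]
          abel
        · simp [h2 g v hv, h2' g v hv]
      smul_mem' := by
        rintro c u ⟨f, p, h1, h2⟩
        refine ⟨c • f, c • p, ?_, fun g v hv => ?_⟩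
        · rw [map_smul, ← h1, Submodule.coe_smul, Submodule.coe_smul, smul_sub, smul_comm]
        · simp [h2 g v hv] }
  suffices hW : W = ⊤ by
    have : u ∈ W := hW ▸ Submodule.mem_top
    exact this
  refine eq_top_of_forall_inner_eq_zero fun f hf => eq_of_eventually_evalAt_eq ?_
  filter_upwards [eventually_mem_hol M, eventually_mem_hol N,
    (Set.finite_singleton α).compl_mem_cofinite] with w hM hN hwα hw
  rw [map_zero]
  have hwα' : conj w - α ≠ 0 := by
    rw [← hα, ← map_sub]
    exact (map_ne_zero _).mpr (sub_ne_zero.mpr hwα)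
  have key : ∀ x, star x ⬝ᵥ 𝔅.evalAt w hw f = 0 := by
    intro x
    obtain ⟨k, hk1, hk2⟩ := hK w hw x
    rw [← hk2]
    -- For `u = k = K(·,w)x` take `f = k / (w^* - α)`: then `(z - α) f - k = (z - w^*) k / (w^* -
    -- α)`, and the pairing identity is `v(w) = (w - α) g(w)`.
    refine hf k ⟨(conj w - α)⁻¹ • k,
      (conj w - α)⁻¹ • ((matValue N w)ᴴ *ᵥ x, (matValue M w)ᴴ *ᵥ x), ?_, fun g v hv => ?_⟩
    · rw [map_smul, ← X_sub_C_smul_kernel_eq hMN hw hM hN hk1, Submodule.coe_smul]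
      ext i
      have hC : (RatFunc.C (conj w - α)⁻¹ : RatFunc ℂ) * (RatFunc.C (conj w) - RatFunc.C α) = 1 := by
        rw [← map_sub, ← map_mul, inv_mul_cancel₀ hwα', map_one]
      simp only [Pi.sub_apply, Pi.smul_apply, smul_eq_mul, RatFunc.smul_eq_C_mul]
      linear_combination (k.1 i) * hC
    · rw [← 𝔅.conj_symm g, hk2, map_smul, LinearMap.smul_apply, ← 𝔅.conj_symm v, hk2,
        evalAt_of_eq_X_sub_C_smul hw hv, dotProduct_smul, smul_eq_mul, smul_eq_mul, map_mul,
        map_sub, hα, inv_mul_cancel_left₀ hwα']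
  funext i
  have := key (Pi.single i 1)
  rwa [← Pi.single_star, star_one, single_one_dotProduct] at this

theorem mulOpSymmetric_and_ran_eq_ker_of_nevanlinna (hK : 𝔅.IsReproducingKernel K)
    (h : IsRationalNevanlinnaKernel 𝔅.polesᶜ K) :
    𝔅.MulOpSymmetric ∧
      ∃ (α : ℂ) (hα : α ∉ 𝔅.poles), 𝔅.ranMulOpSub α = LinearMap.ker (𝔅.evalAt α hα) := by
  obtain ⟨M, N, hsymm, hrank, hMN⟩ := h
  obtain ⟨C, D, hCD⟩ := exists_eventually_det_ne_zero hrank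
  obtain ⟨α, hα, hdet, hαM, hαN, hαp⟩ := exists_real_of_eventually_cofinite
    (hCD.and ((eventually_mem_hol M).and ((eventually_mem_hol N).and 𝔅.eventually_not_mem_poles)))
  have key : ∀ u ∈ LinearMap.ker (𝔅.evalAt α hαp), ∃ f : 𝔅.carrier,
      u.1 = (RatFunc.X - RatFunc.C α) • f.1 ∧ ∀ g v : 𝔅.carrier,
        v.1 = (RatFunc.X - RatFunc.C α) • g.1 → 𝔅.inner u g = 𝔅.inner f v := by
    intro u hu
    obtain ⟨f, p, h1, h2⟩ := exists_X_sub_C_smul_sub_eq_mulVecSub hK hMN hα u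
    have hp : matValue M α *ᵥ p.1 - matValue N α *ᵥ p.2 = 0 := by
      funext i
      rw [← value_mulVecSub hαM hαN, ← h1]
      change value ((RatFunc.X - RatFunc.C α) * f.1 i - u.1 i) α = 0
      rw [value_sub (mul_mem (X_sub_C_mem_regularAt α α) (mem_regularAt_of_not_mem_poles hαp f i))
        (mem_regularAt_of_not_mem_poles hαp u i),
        value_X_sub_C_mul α (mem_regularAt_of_not_mem_poles hαp f i), sub_self, zero_mul,
        ← evalAt_apply hαp, LinearMap.mem_ker.mp hu]
      simp
    have hs := hsymm α ⟨hαM, hαN⟩ (hα.symm ▸ ⟨hαM, hαN⟩)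
    rw [hα] at hs
    obtain ⟨x, hx1, hx2⟩ := exists_eq_conjTranspose_mulVec hs hdet hp
    obtain ⟨k, hk1, hk2⟩ := hK α hαp x
    have hk := X_sub_C_smul_kernel_eq hMN hαp hαM hαN hk1
    rw [← hx1, ← hx2, hα, ← h1] at hk
    -- `(z - α) k` is exactly the defect `(z - α) f - u`; and `[k, v] = 0` because `v = (S - α) g`
    -- vanishes at `α`.
    refine ⟨f - k, ?_, fun g v hv => ?_⟩
    · rw [Submodule.coe_sub, smul_sub, hk, sub_sub_cancel]
    · rw [h2 g v hv, map_sub, LinearMap.sub_apply, ← 𝔅.conj_symm v k, hk2,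
        evalAt_of_eq_X_sub_C_smul hαp hv]
      simp
  refine ⟨(mulOpSymmetric_iff hα).mpr fun f g u v hu hv => ?_, α, hαp,
    le_antisymm (ranMulOpSub_le_ker hαp) fun u hu => ?_⟩
  -- The quotient of `u` by `z - α` is unique, so the `f'` supplied by `key` is `f` itself and its
  -- pairing identity is symmetry.
  · have hu' := ranMulOpSub_le_ker hαp (X_smul_eq_of_mem_ranMulOpSub.mpr ⟨f, hu⟩)
    obtain ⟨f', hf', h⟩ := key u hu'
    rw [h g v hv, Subtype.ext (X_sub_C_smul_injective α (hf'.symm.trans hu))]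
  · obtain ⟨f, hf, -⟩ := key u hu
    exact X_smul_eq_of_mem_ranMulOpSub.mpr ⟨f, hf⟩

end PontryaginSpace

open Topology

/-! ### Linear algebra and continuity for the converse -/

section LinearAlgebra

variable {V W : Type*} [AddCommGroup V] [Module ℂ V] [AddCommGroup W] [Module ℂ W]

theorem exists_leftInverse_domRestrict {E : V →ₗ[ℂ] W} {C : Submodule ℂ V}
    (hC : Disjoint (LinearMap.ker E) C) :
    ∃ G : W →ₗ[ℂ] C, G ∘ₗ E.domRestrict C = LinearMap.id := by
  refine (E.domRestrict C).exists_leftInverse_of_injective ?_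
  rw [eq_bot_iff]
  intro f hf
  exact Subtype.ext (Submodule.disjoint_def.mp hC f.1 hf f.2)

/-- Injectivity on a subspace on which `E` is injective can be tested by a determinant. -/
theorem exists_det_ne_zero_imp_disjoint_ker [FiniteDimensional ℂ V] {d : ℕ}
    {E : V →ₗ[ℂ] Fin d → ℂ} {C : Submodule ℂ V} (hC : Disjoint (LinearMap.ker E) C) :
    ∃ (n : ℕ) (G : Matrix (Fin n) (Fin d) ℂ) (c : Fin n → V),
      (Matrix.of fun i j => (G *ᵥ E (c j)) i) = 1 ∧ ∀ F : V →ₗ[ℂ] Fin d → ℂ,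
        (Matrix.of fun i j => (G *ᵥ F (c j)) i).det ≠ 0 → Disjoint (LinearMap.ker F) C := by
  -- With `G` a left inverse of `E` on `C`, the test is the determinant of `G ∘ F` on `C`, which is
  -- `1` for `F = E`.
  obtain ⟨G, hG⟩ := exists_leftInverse_domRestrict hC
  let b := Module.finBasis ℂ C
  have h : ∀ F : V →ₗ[ℂ] Fin d → ℂ,
      (Matrix.of fun i j => (LinearMap.toMatrix (Pi.basisFun ℂ (Fin d)) b G *ᵥ F (b j)) i) =
        LinearMap.toMatrix b b (G ∘ₗ F.domRestrict C) := by
    intro F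
    ext i j
    rw [LinearMap.toMatrix_apply, Matrix.of_apply]
    exact congrFun (LinearMap.toMatrix_mulVec_repr (Pi.basisFun ℂ (Fin d)) b G (F (b j))) i
  refine ⟨_, LinearMap.toMatrix (Pi.basisFun ℂ (Fin d)) b G, fun j => b j, ?_, fun F hF => ?_⟩
  · rw [h, hG, LinearMap.toMatrix_id]
  · rw [h, LinearMap.det_toMatrix] at hF
    rw [Submodule.disjoint_def]
    intro f hf hfC
    have h1 : LinearMap.equivOfDetNeZero _ hF ⟨f, hfC⟩ = 0 := by
      change G (F f) = 0
      rw [LinearMap.mem_ker.mp hf, map_zero]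
    exact congrArg Subtype.val ((LinearEquiv.map_eq_zero_iff _).mp h1)

/-- A right inverse of `E` onto its range, extended to all of `W`. It is needed because `E_α` need
not be onto `ℂ^d`. -/
theorem exists_generalized_inverse (E : V →ₗ[ℂ] W) :
    ∃ σ : W →ₗ[ℂ] V, ∀ f, E (σ (E f)) = E f := by
  obtain ⟨g, hg⟩ := E.rangeRestrict.exists_rightInverse_of_surjective E.range_rangeRestrict
  obtain ⟨σ, hσ⟩ := g.exists_extend
  refine ⟨σ, fun f => ?_⟩
  have h1 : σ (E f) = g (E.rangeRestrict f) := LinearMap.congr_fun hσ (E.rangeRestrict f)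
  have h2 := LinearMap.congr_fun hg (E.rangeRestrict f)
  rw [h1]
  exact congrArg Subtype.val h2

end LinearAlgebra

section MatrixFunctions

variable {d : ℕ}

theorem continuousAt_matValue {M : Matrix (Fin d) (Fin d) (RatFunc ℂ)} {z : ℂ} (hz : z ∈ hol M) :
    ContinuousAt (matValue M) z :=
  continuousAt_pi.mpr fun i => continuousAt_pi.mpr fun j => continuousAt_value (hz i j)

theorem eq_zero_of_eventually_eq_zero {E : Type*} [TopologicalSpace E] [T2Space E] [Zero E]
    {F : ℂ → E} {z : ℂ} (hF : ContinuousAt F z) (h : ∀ᶠ w in cofinite, F w = 0) : F z = 0 := by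
  have h1 : Tendsto F (𝓝[≠] z) (𝓝 (F z)) := hF.tendsto.mono_left nhdsWithin_le_nhds
  have h2 : Tendsto F (𝓝[≠] z) (𝓝 0) :=
    tendsto_const_nhds.congr' (((h.filter_mono (nhdsNE_le_cofinite z))).mono fun _ h => h.symm)
  exact tendsto_nhds_unique h1 h2

/-- Both products are continuous where all factors are holomorphic, so finitely many exceptional
points can be filled in by limits. -/
theorem mul_conjTranspose_sub_eq_zero_of_eventually {M N : Matrix (Fin d) (Fin d) (RatFunc ℂ)}
    (h : ∀ᶠ z in cofinite,
      matValue M z * (matValue N (conj z))ᴴ - matValue N z * (matValue M (conj z))ᴴ = 0) :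
    ∀ z ∈ hol M ∩ hol N, conj z ∈ hol M ∩ hol N →
      matValue M z * (matValue N (conj z))ᴴ - matValue N z * (matValue M (conj z))ᴴ = 0 := by
  rintro z ⟨hM, hN⟩ ⟨hM', hN'⟩
  refine eq_zero_of_eventually_eq_zero (F := fun z => matValue M z * (matValue N (conj z))ᴴ -
    matValue N z * (matValue M (conj z))ᴴ) ?_ h
  have hc : ∀ A : Matrix (Fin d) (Fin d) (RatFunc ℂ), conj z ∈ hol A →
      ContinuousAt (fun z => (matValue A (conj z))ᴴ) z := fun A hA =>
    (continuous_id.matrix_conjTranspose.continuousAt).comp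
      (ContinuousAt.comp (f := fun z => conj z) (continuousAt_matValue hA)
        Complex.continuous_conj.continuousAt)
  exact ((continuousAt_matValue hM).mul (hc N hN')).sub ((continuousAt_matValue hN).mul (hc M hM'))

theorem rank_fromCols_zero_one :
    (Matrix.fromCols (0 : Matrix (Fin d) (Fin d) ℂ) (1 : Matrix (Fin d) (Fin d) ℂ)).rank = d := by
  refine le_antisymm ((Matrix.rank_le_card_height _).trans_eq (Fintype.card_fin d)) ?_
  have h := Matrix.rank_mul_le_left
    (Matrix.fromCols (0 : Matrix (Fin d) (Fin d) ℂ) (1 : Matrix (Fin d) (Fin d) ℂ))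
    (Matrix.fromRows (0 : Matrix (Fin d) (Fin d) ℂ) (1 : Matrix (Fin d) (Fin d) ℂ))
  rw [Matrix.fromCols_mul_fromRows] at h
  simpa using h

end MatrixFunctions

/-! ### From symmetry and the range condition to a Nevanlinna kernel -/

namespace PontryaginSpace

variable {d : ℕ} {𝔅 : PontryaginSpace d}

/-- `S - α` is injective for every `α`, so the dimension of its range does not depend on `α`. -/
theorem finrank_ranMulOpSub (α : ℂ) :
    Module.finrank ℂ (𝔅.ranMulOpSub α) = Module.finrank ℂ 𝔅.mulOp.domain := by
  refine LinearMap.finrank_range_of_inj fun f g hfg => ?_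
  have h : ∀ f : 𝔅.mulOp.domain, ((𝔅.mulOp.toFun - α • 𝔅.mulOp.domain.subtype) f).1 =
      (RatFunc.X - RatFunc.C α) • f.1.1 := by
    intro f
    change (RatFunc.X : RatFunc ℂ) • f.1.1 - α • f.1.1 = _
    ext i
    simp [sub_mul, RatFunc.smul_eq_C_mul]
  exact Subtype.ext (Subtype.ext (X_sub_C_smul_injective α
    ((h f).symm.trans ((congrArg Subtype.val hfg).trans (h g)))))

/-- If `E_α` is injective on a subspace, then so is `E_β` for almost all `β`. -/
theorem eventually_disjoint_ker_evalAt {C : Submodule ℂ 𝔅.carrier} {α : ℂ} (hα : α ∉ 𝔅.poles)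
    (hC : Disjoint (LinearMap.ker (𝔅.evalAt α hα)) C) :
    ∀ᶠ β in cofinite, ∀ hβ : β ∉ 𝔅.poles, Disjoint (LinearMap.ker (𝔅.evalAt β hβ)) C := by
  have := 𝔅.finiteDimensional
  obtain ⟨n, G, c, h1, hdisj⟩ := exists_det_ne_zero_imp_disjoint_ker hC
  let A : Matrix (Fin n) (Fin n) (RatFunc ℂ) := Matrix.of fun i j =>
    ∑ k, RatFunc.C (G i k) * (c j).1 k
  have hreg : ∀ β (_ : β ∉ 𝔅.poles) i j k,
      RatFunc.C (G i k) * (c j).1 k ∈ regularAt β := fun β hβ i j k =>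
    mul_mem (C_mem_regularAt _ _) (mem_regularAt_of_not_mem_poles hβ (c j) k)
  have hval : ∀ β (hβ : β ∉ 𝔅.poles), A.map (fun r => value r β) =
      Matrix.of fun i j => (G *ᵥ 𝔅.evalAt β hβ (c j)) i := by
    intro β hβ
    ext i j
    change value (∑ k, RatFunc.C (G i k) * (c j).1 k) β = ∑ k, G i k * 𝔅.evalAt β hβ (c j) k
    rw [value_sum _ _ (hreg β hβ i j)]
    refine Finset.sum_congr rfl fun k _ => ?_
    rw [value_mul (C_mem_regularAt _ _) (mem_regularAt_of_not_mem_poles hβ (c j) k), value_C,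
      evalAt_apply]
  have hA : ∀ i j, A i j ∈ regularAt α := fun i j => by
    change ∑ k, RatFunc.C (G i k) * (c j).1 k ∈ regularAt α
    exact sum_mem fun k _ => hreg α hα i j k
  have hdet := eventually_det_ne_zero A hA
    (by rw [hval α hα, h1, Matrix.det_one]; exact one_ne_zero)
  filter_upwards [hdet] with β h hβ
  rw [hval β hβ] at h
  exact hdisj _ h

/-- For almost all `β`, `E_β` stays injective on a complement of `ker E_α`, so `dim ker E_β ≤ dim
ker E_α = dim ran (S - β)`; the inclusion `ran (S - β) ⊆ ker E_β` always holds. -/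
theorem eventually_ranMulOpSub_eq_ker {α : ℂ} (hα : α ∉ 𝔅.poles)
    (h : 𝔅.ranMulOpSub α = LinearMap.ker (𝔅.evalAt α hα)) :
    ∀ᶠ β in cofinite, ∀ hβ : β ∉ 𝔅.poles,
      𝔅.ranMulOpSub β = LinearMap.ker (𝔅.evalAt β hβ) := by
  have := 𝔅.finiteDimensional
  obtain ⟨C, hC⟩ := Submodule.exists_isCompl (LinearMap.ker (𝔅.evalAt α hα))
  filter_upwards [eventually_disjoint_ker_evalAt hα hC.disjoint] with β hβ hβp
  refine Submodule.eq_of_le_of_finrank_le (ranMulOpSub_le_ker hβp) ?_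
  have h1 := Submodule.finrank_add_eq_of_isCompl hC
  have h2 := Submodule.finrank_add_finrank_le_of_disjoint (hβ hβp)
  rw [finrank_ranMulOpSub, ← finrank_ranMulOpSub α, h]
  omega

/-- A Hermitian form on `𝔅` is represented by a selfadjoint operator. -/
theorem exists_selfAdjoint_of_hermitian (h : 𝔅.carrier → 𝔅.carrier →ₗ[ℂ] ℂ)
    (hh : ∀ f g, conj (h f g) = h g f) :
    ∃ T : 𝔅.carrier →ₗ[ℂ] 𝔅.carrier, (∀ f g, 𝔅.inner g (T f) = h f g) ∧
      ∀ f g, 𝔅.inner (T f) g = 𝔅.inner f (T g) := by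
  choose T hT using fun f => 𝔅.exists_representer (h f)
  refine ⟨{ toFun := T, map_add' := fun f g => ?_, map_smul' := fun c f => ?_ }, hT, ?_⟩
  · refine ext_inner_left fun k => ?_
    rw [map_add, hT, hT, hT, ← hh k, map_add, map_add, hh, hh]
  · refine ext_inner_left fun k => ?_
    rw [RingHom.id_apply, map_smulₛₗ, hT, hT, ← hh k, map_smul, smul_eq_mul, map_mul, hh,
      smul_eq_mul]
  · intro f g
    change 𝔅.inner (T f) g = 𝔅.inner f (T g)
    rw [← 𝔅.conj_symm, hT, hT, hh]

/-- A symmetric operator defined on a subspace of `𝔅` extends to a selfadjoint operator. -/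
theorem exists_selfAdjoint_extension {D : Submodule ℂ 𝔅.carrier} (B : D →ₗ[ℂ] 𝔅.carrier)
    (hB : ∀ f g : D, 𝔅.inner (B f) g = 𝔅.inner f (B g)) :
    ∃ T : 𝔅.carrier →ₗ[ℂ] 𝔅.carrier, (∀ f : D, T f = B f) ∧
      ∀ f g, 𝔅.inner (T f) g = 𝔅.inner f (T g) := by
  obtain ⟨P, hP⟩ := exists_leftInverse_domRestrict (E := LinearMap.id) (C := D)
    (by rw [LinearMap.ker_id]; exact disjoint_bot_left)
  have hP' : ∀ f : D, P f = f := fun f => LinearMap.congr_fun hP f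
  -- `D` may be degenerate, so `P` is an arbitrary projection onto `D` rather than an orthogonal
  -- one. Symmetry of `B` makes the form Hermitian, and for `f ∈ D` the last two terms cancel.
  let h : 𝔅.carrier → 𝔅.carrier →ₗ[ℂ] ℂ := fun f =>
    𝔅.inner.flip (B (P f)) + (𝔅.inner.flip f) ∘ₗ B ∘ₗ P -
      (𝔅.inner.flip (B (P f))) ∘ₗ D.subtype ∘ₗ P
  have h_apply : ∀ f g, h f g = 𝔅.inner g (B (P f)) + 𝔅.inner (B (P g)) f -
    𝔅.inner (P g) (B (P f)) := fun f g => rfl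
  obtain ⟨T, hT, hT'⟩ := exists_selfAdjoint_of_hermitian h fun f g => by
    rw [h_apply, h_apply, map_sub, map_add, 𝔅.conj_symm, 𝔅.conj_symm, 𝔅.conj_symm, hB, add_comm]
  refine ⟨T, fun f => ext_inner_left fun g => ?_, hT'⟩
  rw [hT, h_apply, hP', hB, add_sub_cancel_right]

theorem exists_selfAdjoint_inverse_mulOp_sub {α : ℂ} (hα : conj α = α) (hαp : α ∉ 𝔅.poles)
    (hS : 𝔅.MulOpSymmetric) (hran : 𝔅.ranMulOpSub α = LinearMap.ker (𝔅.evalAt α hαp)) :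
    ∃ T : 𝔅.carrier →ₗ[ℂ] 𝔅.carrier, (∀ f, 𝔅.evalAt α hαp f = 0 →
        f.1 = (RatFunc.X - RatFunc.C α) • (T f).1) ∧
      ∀ f g, 𝔅.inner (T f) g = 𝔅.inner f (T g) := by
  have hex : ∀ f : LinearMap.ker (𝔅.evalAt α hαp), ∃ g : 𝔅.carrier,
      f.1.1 = (RatFunc.X - RatFunc.C α) • g.1 := fun f =>
    X_smul_eq_of_mem_ranMulOpSub.mp (hran.ge f.2)
  choose B hB using hex
  obtain ⟨T, hT, hT'⟩ := exists_selfAdjoint_extension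
    ({ toFun := B
       map_add' := fun f g => Subtype.ext (X_sub_C_smul_injective α (by
         rw [← hB, Submodule.coe_add, Submodule.coe_add, Submodule.coe_add, smul_add, ← hB, ← hB]))
       map_smul' := fun c f => Subtype.ext (X_sub_C_smul_injective α (by
         rw [← hB, RingHom.id_apply, Submodule.coe_smul, Submodule.coe_smul, Submodule.coe_smul,
           smul_comm, ← hB])) } : LinearMap.ker (𝔅.evalAt α hαp) →ₗ[ℂ] 𝔅.carrier)
    (fun f g => ((mulOpSymmetric_iff hα).mp hS (B f) (B g) f.1 g.1 (hB f) (hB g)).symm)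
  exact ⟨T, fun f hf => (hB ⟨f, hf⟩).trans
    (congrArg (fun g : 𝔅.carrier => (RatFunc.X - RatFunc.C α : RatFunc ℂ) • g.1) (hT ⟨f, hf⟩).symm),
    hT'⟩

/-- There is a rational matrix function `N` with `N(α) = 1` and
`N(z) f(α) = f(z) - (z - α) (T f)(z)`. -/
theorem exists_ratMatrix_mulVec_evalAt {α : ℂ} (hαp : α ∉ 𝔅.poles)
    {T : 𝔅.carrier →ₗ[ℂ] 𝔅.carrier}
    (hT : ∀ f, 𝔅.evalAt α hαp f = 0 → f.1 = (RatFunc.X - RatFunc.C α) • (T f).1) :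
    ∃ N : Matrix (Fin d) (Fin d) (RatFunc ℂ), matValue N α = 1 ∧
      ∀ z (hz : z ∉ 𝔅.poles), z ∈ hol N ∧ ∀ f, matValue N z *ᵥ 𝔅.evalAt α hαp f =
        𝔅.evalAt z hz f - (z - α) • 𝔅.evalAt z hz (T f) := by
  obtain ⟨σ, hσ⟩ := exists_generalized_inverse (𝔅.evalAt α hαp)
  let e : Fin d → Fin d → ℂ := fun j => Pi.single j 1
  -- The constant last term vanishes on the range of `E_α`; off that range it makes `N(α) = 1`.
  let N : Matrix (Fin d) (Fin d) (RatFunc ℂ) := Matrix.of fun i j =>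
    (σ (e j)).1 i - (RatFunc.X - RatFunc.C α) * (T (σ (e j))).1 i +
      RatFunc.C ((e j - 𝔅.evalAt α hαp (σ (e j))) i)
  have hreg1 : ∀ z, z ∉ 𝔅.poles → ∀ i j, (σ (e j)).1 i ∈ regularAt z := fun z hz i j =>
    mem_regularAt_of_not_mem_poles hz _ i
  have hreg2 : ∀ z, z ∉ 𝔅.poles → ∀ i j, (T (σ (e j))).1 i ∈ regularAt z := fun z hz i j =>
    mem_regularAt_of_not_mem_poles hz _ i
  have hreg3 : ∀ z, z ∉ 𝔅.poles → ∀ i j,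
      (RatFunc.X - RatFunc.C α) * (T (σ (e j))).1 i ∈ regularAt z := fun z hz i j =>
    mul_mem (X_sub_C_mem_regularAt α z) (hreg2 z hz i j)
  have hval : ∀ z (hz : z ∉ 𝔅.poles), matValue N z = LinearMap.toMatrix'
      (𝔅.evalAt z hz ∘ₗ σ - (z - α) • (𝔅.evalAt z hz ∘ₗ T ∘ₗ σ) +
        (LinearMap.id - 𝔅.evalAt α hαp ∘ₗ σ)) := by
    intro z hz
    ext i j
    rw [LinearMap.toMatrix'_apply]
    change value ((σ (e j)).1 i - (RatFunc.X - RatFunc.C α) * (T (σ (e j))).1 i +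
      RatFunc.C ((e j - 𝔅.evalAt α hαp (σ (e j))) i)) z = _
    rw [value_add (sub_mem (hreg1 z hz i j) (hreg3 z hz i j)) (C_mem_regularAt _ _),
      value_sub (hreg1 z hz i j) (hreg3 z hz i j), value_X_sub_C_mul α (hreg2 z hz i j), value_C]
    rfl
  refine ⟨N, ?_, fun z hz => ⟨fun i j =>
    add_mem (sub_mem (hreg1 z hz i j) (hreg3 z hz i j)) (C_mem_regularAt _ _), fun f => ?_⟩⟩
  · rw [hval α hαp, sub_self, zero_smul, sub_zero, add_sub_cancel, LinearMap.toMatrix'_id]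
  · rw [hval z hz, LinearMap.toMatrix'_mulVec]
    simp only [LinearMap.add_apply, LinearMap.sub_apply, LinearMap.comp_apply,
      LinearMap.smul_apply, LinearMap.id_apply, hσ, sub_self, add_zero]
    -- `f` and `σ (f(α))` agree at `α`, so their difference is `z - α` times its image under `T`.
    have h := evalAt_of_eq_X_sub_C_smul hz
      (hT (f - σ (𝔅.evalAt α hαp f)) (by rw [map_sub, hσ, sub_self]))
    rw [map_sub, map_sub, map_sub, smul_sub] at h
    rw [eq_comm, ← sub_eq_zero, ← sub_eq_zero.mpr h]
    abel

variable {K : ℂ → ℂ → Matrix (Fin d) (Fin d) ℂ}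

theorem conjTranspose_kernel (hK : 𝔅.IsReproducingKernel K) {z w : ℂ} (hz : z ∉ 𝔅.poles)
    (hw : w ∉ 𝔅.poles) : (K z w)ᴴ = K w z := by
  ext i j
  obtain ⟨k, hk1, hk2⟩ := hK w hw (Pi.single i 1)
  obtain ⟨l, hl1, hl2⟩ := hK z hz (Pi.single j 1)
  have h1 := hk2 l
  have h2 := hl2 k
  rw [hl1 w hw, ← Pi.single_star, star_one, single_one_dotProduct, Matrix.mulVec_single_one] at h1
  rw [hk1 z hz, ← Pi.single_star, star_one, single_one_dotProduct, Matrix.mulVec_single_one] at h2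
  rw [← 𝔅.conj_symm, h2] at h1
  exact h1

theorem isRationalNevanlinnaKernel_of_symmetric (hK : 𝔅.IsReproducingKernel K)
    (hS : 𝔅.MulOpSymmetric)
    (h : ∃ (α : ℂ) (hα : α ∉ 𝔅.poles), 𝔅.ranMulOpSub α = LinearMap.ker (𝔅.evalAt α hα)) :
    IsRationalNevanlinnaKernel 𝔅.polesᶜ K := by
  obtain ⟨α₀, hα₀, h₀⟩ := h
  obtain ⟨α, hα, hran, hαp⟩ := exists_real_of_eventually_cofinite
    ((eventually_ranMulOpSub_eq_ker hα₀ h₀).and 𝔅.eventually_not_mem_poles)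
  obtain ⟨T, hT, hT'⟩ := exists_selfAdjoint_inverse_mulOp_sub hα hαp hS (hran hαp)
  obtain ⟨N, hNα, hN⟩ := exists_ratMatrix_mulVec_evalAt hαp hT
  choose k hk hk' using hK
  let M : Matrix (Fin d) (Fin d) (RatFunc ℂ) := Matrix.of fun i j =>
    (RatFunc.X - RatFunc.C α) * (k α hαp (Pi.single j 1)).1 i
  have hM : ∀ z, z ∉ 𝔅.poles → z ∈ hol M := fun z hz i j =>
    mul_mem (X_sub_C_mem_regularAt α z) (mem_regularAt_of_not_mem_poles hz _ i)
  have hMval : ∀ z, z ∉ 𝔅.poles → matValue M z = (z - α) • K z α := by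
    intro z hz
    ext i j
    change value ((RatFunc.X - RatFunc.C α) * (k α hαp (Pi.single j 1)).1 i) z = _
    rw [value_X_sub_C_mul α (mem_regularAt_of_not_mem_poles hz _ i), ← evalAt_apply hz, hk,
      Matrix.mulVec_single_one]
    rfl
  have key : ∀ z, z ∉ 𝔅.poles → ∀ w, w ∉ 𝔅.poles →
      matValue M z * (matValue N w)ᴴ - matValue N z * (matValue M w)ᴴ = (z - conj w) • K z w := by
    intro z hz w hw
    refine Matrix.ext_of_mulVec_single fun j => ?_
    generalize (Pi.single j 1 : Fin d → ℂ) = x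
    -- Pairing `f` with the left side gives `x^* N(w) f(α) = x^* (f(w) - (w - α)(T f)(w))`; then `T`
    -- is moved to the other side.
    have h1 : k α hαp ((matValue N w)ᴴ *ᵥ x) = k w hw x - (conj w - α) • T (k w hw x) := by
      refine ext_inner_left fun f => ?_
      rw [hk', Matrix.star_mulVec, Matrix.conjTranspose_conjTranspose, ← Matrix.dotProduct_mulVec,
        (hN w hw).2, dotProduct_sub, dotProduct_smul, ← hk', ← hk', hT', map_sub, map_smulₛₗ,
        map_sub, Complex.conj_conj, hα]
    have h2 : (matValue M w)ᴴ *ᵥ x = (conj w - α) • 𝔅.evalAt α hαp (k w hw x) := by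
      rw [hMval w hw, Matrix.conjTranspose_smul, conjTranspose_kernel
        (fun w hw x => ⟨k w hw x, hk w hw x, hk' w hw x⟩) hw hαp, Matrix.smul_mulVec, hk,
        star_sub]
      change (conj w - conj α) • _ = _
      rw [hα]
    rw [Matrix.sub_mulVec, ← Matrix.mulVec_mulVec, ← Matrix.mulVec_mulVec, h2, hMval z hz,
      Matrix.smul_mulVec, ← hk α hαp _ z hz, h1, Matrix.mulVec_smul, (hN z hz).2,
      Matrix.smul_mulVec, ← hk w hw x z hz, map_sub, map_smul]
    module
  refine ⟨M, N, mul_conjTranspose_sub_eq_zero_of_eventually ?_,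
    ⟨α, ⟨hM α hαp, (hN α hαp).1⟩, ?_⟩, ?_⟩
  · filter_upwards [𝔅.eventually_not_mem_poles,
      (star_injective (R := ℂ)).tendsto_cofinite.eventually 𝔅.eventually_not_mem_poles] with z h1 h2
    rw [key z h1 (conj z) h2, Complex.conj_conj, sub_self, zero_smul]
  · rw [hMval α hαp, hNα, sub_self, zero_smul]
    exact rank_fromCols_zero_one
  · rintro z ⟨hz, -⟩ w ⟨hw, -⟩ hzw
    rw [nevanlinnaKernel, key z hz w hw, inv_smul_smul₀ (sub_ne_zero.mpr hzw)]

end PontryaginSpace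

end RationalPontryagin

end

theorem corollary6p1 {d : ℕ} (𝔅 : RationalPontryagin.PontryaginSpace d)
    (K : ℂ → ℂ → Matrix (Fin d) (Fin d) ℂ) (hK : 𝔅.IsReproducingKernel K) :
    RationalPontryagin.IsRationalNevanlinnaKernel 𝔅.polesᶜ K ↔
      (𝔅.MulOpSymmetric ∧
        ∃ (α : ℂ) (hα : α ∉ 𝔅.poles), 𝔅.ranMulOpSub α = LinearMap.ker (𝔅.evalAt α hα)) :=
  ⟨RationalPontryagin.PontryaginSpace.mulOpSymmetric_and_ran_eq_ker_of_nevanlinna hK,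
    fun h => RationalPontryagin.PontryaginSpace.isRationalNevanlinnaKernel_of_symmetric hK h.1 h.2⟩
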